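/- Let $n=2$ or $n=3$, and let $f\in C^3(\mathbb R^n)$ and $g\in C^2(\mathbb R^n)$ be real-valued. Suppose there are constants $R>0$, $C_0>0$ and $\kappa>0$ such that, for all $x\in\mathbb R^n$ with $|x|\ge R$, $$f(x)>0\qquad\text{and}\qquad \frac{f(x)}{1+|x|}-|\nabla f(x)|+g(x)\ \ge\ \frac{C_0}{(1+|x|)^{1+\kappa}} .$$ Let $u^0\in C^2(\mathbb R^n\times[0,\infty))$ be the classical solution of the Cauchy problem $$u^0_{tt}-\Delta u^0=0\ \text{ in }\mathbb R^n\times[0,\infty),\qquad u^0(x,0)=f(x),\quad u^0_t(x,0)=g(x)\ \text{ in }\mathbb R^n,$$ and let $$\Sigma_2=\{(x,t)\in\mathbb R^n\times(0,\infty)\ :\ |x|-t\ge\max\{R,\,t-1\}\}.$$ Then, with $dS_\omega$ the surface measure on the unit sphere of $\mathbb R^n$, the following holds. If $n=3$, then for all $(x,t)\in\Sigma_2$, $$u^0(x,t)\ \ge\ \frac{t}{4\pi}\int_{|\omega|=1}\left\{\frac{f(x+t\omega)}{1+|x+t\omega|}-|\nabla f(x+t\omega)|+g(x+t\omega)\right\}dS_\omega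 .$$ If $n=2$, then for all $(x,t)\in\Sigma_2$, $$u^0(x,t)\ \ge\ \frac{1}{2\pi}\int_0^t\frac{\rho}{\sqrt{t^2-\rho^2}}\int_{|\omega|=1}\left\{\frac{f(x+\rho\omega)}{1+|x+\rho\omega|}-|\nabla f(x+\rho\omega)|+g(x+\rho\omega)\right\}dS_\omega\,d\rho .$$ -/

import Mathlib

open MeasureTheory

/-- `u` is a classical (`C²` on `ℝⁿ × [0,∞)`) solution of `u_tt - Δu = 0` in `ℝⁿ × [0,∞)` with
`u(x,0) = f(x)` and `u_t(x,0) = g(x)`. Time derivatives are taken relative to `[0,∞)`, so they are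
one-sided at `t = 0`; the values of `u` at negative times play no role. -/
structure IsFreeWaveSolution {n : ℕ} (f g : EuclideanSpace ℝ (Fin n) → ℝ)
    (u : EuclideanSpace ℝ (Fin n) → ℝ → ℝ) : Prop where
  contDiffOn : ContDiffOn ℝ 2 (fun p : EuclideanSpace ℝ (Fin n) × ℝ => u p.1 p.2)
    (Set.univ ×ˢ Set.Ici 0)
  wave_eq : ∀ x : EuclideanSpace ℝ (Fin n), ∀ t : ℝ, 0 ≤ t →
    iteratedDerivWithin 2 (fun s => u x s) (Set.Ici 0) t - Laplacian.laplacian (fun y => u y t) x = 0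
  initial_position : ∀ x, u x 0 = f x
  initial_velocity : ∀ x, derivWithin (fun s => u x s) (Set.Ici 0) 0 = g x

/-- `∫_{|ω|=1} φ(x + ρω) dS_ω`, with `dS` the (unnormalised) surface measure of the unit sphere. -/
noncomputable def sphereIntegral {n : ℕ} (φ : EuclideanSpace ℝ (Fin n) → ℝ)
    (x : EuclideanSpace ℝ (Fin n)) (ρ : ℝ) : ℝ :=
  ∫ ω : Metric.sphere (0 : EuclideanSpace ℝ (Fin n)) 1,
    φ (x + ρ • (ω : EuclideanSpace ℝ (Fin n)))
      ∂((volume : Measure (EuclideanSpace ℝ (Fin n))).toSphere)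

/-- Kirchhoff's spherical-mean integral (three space dimensions). -/
noncomputable def kirchhoffIntegral (φ : EuclideanSpace ℝ (Fin 3) → ℝ)
    (x : EuclideanSpace ℝ (Fin 3)) (t : ℝ) : ℝ :=
  t / (4 * Real.pi) * sphereIntegral φ x t

/-- Poisson's spherical-mean integral (two space dimensions). -/
noncomputable def poissonIntegral (φ : EuclideanSpace ℝ (Fin 2) → ℝ)
    (x : EuclideanSpace ℝ (Fin 2)) (t : ℝ) : ℝ :=
  1 / (2 * Real.pi) * ∫ ρ in (0 : ℝ)..t, ρ / Real.sqrt (t ^ 2 - ρ ^ 2) * sphereIntegral φ x ρ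

/-- The function `y ↦ f(y)/(1+|y|) - |∇f(y)| + g(y)`. -/
noncomputable def dataCombination {n : ℕ} (f g : EuclideanSpace ℝ (Fin n) → ℝ)
    (y : EuclideanSpace ℝ (Fin n)) : ℝ :=
  f y / (1 + ‖y‖) - ‖gradient f y‖ + g y

/-- The assumption on the initial data in low space dimensions, with constants `R`, `C₀`, `κ`. -/
structure LowDimAssumption {n : ℕ} (f g : EuclideanSpace ℝ (Fin n) → ℝ) (R C₀ κ : ℝ) : Prop where
  contDiff_f : ContDiff ℝ 3 f
  contDiff_g : ContDiff ℝ 2 g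
  R_pos : 0 < R
  C₀_pos : 0 < C₀
  κ_pos : 0 < κ
  f_pos : ∀ y, R ≤ ‖y‖ → 0 < f y
  lower_bound : ∀ y, R ≤ ‖y‖ → C₀ / (1 + ‖y‖) ^ (1 + κ) ≤ dataCombination f g y

/-- `Σ₂ = {(x,t) ∈ ℝⁿ × (0,∞) : |x| - t ≥ max {R, t - 1}}`. -/
def sigmaTwo (n : ℕ) (R : ℝ) : Set (EuclideanSpace ℝ (Fin n) × ℝ) :=
  {p | 0 < p.2 ∧ max R (p.2 - 1) ≤ ‖p.1‖ - p.2}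

/-!
The solution is represented by an average of the Cauchy data over the base of the backward light
cone, and the integrand of that average is then bounded below pointwise.

Fix an apex `(x, t)` and, for `z` in the closed unit ball, follow
`F(r, z) = u + r (∂_z u + ∂_t u)` along the ray `r ↦ (x + r z, t - r)`. By the wave equation its
derivative is `2 ∂_z u + r (∂_z² u - Δu)`, which involves only the spatial derivatives of one time
slice (`IsFreeWaveSolution.hasDerivAt_along_cone`). If a measure `m` on the unit ball annihilates
`D²h(z)(z, z) + 2 Dh(z) z - Δh(z)` for all `C²` functions `h` (`IsHuygensMeasure`), then
`∫ F(r, z) dm(z)` does not depend on `r`; comparing `r = 0` with `r = t` gives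
`m(ℝⁿ) u(x, t) = ∫ f(x + t z) + t (Df(x + t z) z + g(x + t z)) dm(z)`
(`IsHuygensMeasure.integral_data_eq`). This is Kirchhoff's and Poisson's formula at once, and it
applies to any classical solution, with no appeal to uniqueness.

Both measures come from a single fact: the Laplace–Beltrami operator has mean zero over the unit
sphere (`integral_toSphere_laplaceBeltrami`). It follows from rotation invariance, by
differentiating twice along the rotations in the coordinate planes and summing over the planes. For
`n = 3` it says that the surface measure is a Huygens measure. For `n = 2` the measure is
`dz / √(1 - |z|²)` on the disc, and an integration by parts in `θ`, where `|z| = sin θ`, supplies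
the remaining radial terms (`isHuygensMeasure_discMeasure`).

On `Σ₂` every point `y = x + t z` satisfies `|y| ≥ |x| - t ≥ max {R, t - 1}`, so `f(y) > 0` and
`t ≤ 1 + |y|`, whence `f(y) ≥ t f(y) / (1 + |y|)`; together with `Df(y) z ≥ -|∇f(y)|` this is
`mul_dataCombination_le`. In the plane the substitution `ρ = t sin θ` turns the average into the
Poisson integral.
-/

open scoped Pointwise

/-! ### Integrals over the unit sphere -/

section Sphere

variable {E : Type*} [NormedAddCommGroup E] [InnerProductSpace ℝ E] [FiniteDimensional ℝ E]
  [MeasurableSpace E] [BorelSpace E]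

theorem measurePreserving_sphere_linearIsometryEquiv (e : E ≃ₗᵢ[ℝ] E) :
    MeasurePreserving
      (fun ω : Metric.sphere (0 : E) 1 => (⟨e ω, by simp⟩ : Metric.sphere (0 : E) 1))
      (volume : Measure E).toSphere (volume : Measure E).toSphere := by
  have hm : Measurable
      (fun ω : Metric.sphere (0 : E) 1 => (⟨e ω, by simp⟩ : Metric.sphere (0 : E) 1)) :=
    (Continuous.subtype_mk (e.continuous.comp continuous_subtype_val) _).measurable
  refine ⟨hm, ?_⟩
  ext s hs
  rw [Measure.map_apply hm hs, Measure.toSphere_apply' _ (hm hs), Measure.toSphere_apply' _ hs]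
  congr 1
  have hpre : Set.Ioo (0 : ℝ) 1 • (((↑) : Metric.sphere (0 : E) 1 → E) ''
      ((fun ω : Metric.sphere (0 : E) 1 => (⟨e ω, by simp⟩ : Metric.sphere (0 : E) 1)) ⁻¹' s))
      = e ⁻¹' (Set.Ioo (0 : ℝ) 1 • (((↑) : Metric.sphere (0 : E) 1 → E) '' s)) := by
    ext y
    simp only [Set.mem_smul, Set.mem_image, Set.mem_preimage]
    constructor
    · rintro ⟨r, hr, _, ⟨ω, hω, rfl⟩, rfl⟩
      exact ⟨r, hr, e ω, ⟨_, hω, rfl⟩, by simp⟩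
    · rintro ⟨r, hr, _, ⟨ω, hω, rfl⟩, h⟩
      refine ⟨r, hr, e.symm ω, ⟨⟨e.symm ω, by simp⟩, by simpa using hω, rfl⟩, ?_⟩
      rw [← e.symm_apply_apply y, ← h, map_smul]
  rw [hpre]
  exact e.measurePreserving.measure_preimage_equiv (f := e.toHomeomorph.toMeasurableEquiv) _

theorem integral_toSphere_comp_linearIsometryEquiv (e : E ≃ₗᵢ[ℝ] E) (h : E → ℝ)
    (hc : Continuous h) :
    ∫ ω : Metric.sphere (0 : E) 1, h (e ω) ∂(volume : Measure E).toSphere =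
      ∫ ω : Metric.sphere (0 : E) 1, h ω ∂(volume : Measure E).toSphere := by
  have hp := measurePreserving_sphere_linearIsometryEquiv e
  conv_rhs => rw [← hp.map_eq]
  exact (integral_map hp.measurable.aemeasurable
    (hc.comp continuous_subtype_val).aestronglyMeasurable).symm

/-- Infinitesimal rotation invariance of the surface measure: the derivative of `h` along the
rotation field `x ↦ A x` of a skew-adjoint `A` has integral zero over the sphere. -/
theorem integral_toSphere_fderiv_skewAdjoint (A : E →L[ℝ] E) (hA : A ∈ skewAdjoint (E →L[ℝ] E))
    (h : E → ℝ) (hh : ContDiff ℝ 1 h) :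
    ∫ ω : Metric.sphere (0 : E) 1, fderiv ℝ h ω (A ω) ∂(volume : Measure E).toSphere = 0 := by
  let : NormedAlgebra ℚ (E →L[ℝ] E) := .restrictScalars ℚ ℝ _
  have hu (s : ℝ) : NormedSpace.exp (s • A) ∈ unitary (E →L[ℝ] E) :=
    NormedSpace.exp_mem_unitary_of_mem_skewAdjoint (skewAdjoint.smul_mem s hA)
  -- The one-parameter group of rotations generated by `A`.
  set U : ℝ → (E →L[ℝ] E) := fun s => NormedSpace.exp (s • A) with hU
  have hUn (s : ℝ) (x : E) : ‖U s x‖ = ‖x‖ :=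
    (Unitary.linearIsometryEquiv ⟨U s, hu s⟩).norm_map x
  have hd (s : ℝ) (x : E) : HasDerivAt (fun s => U s x) (U s (A x)) s :=
    (hasDerivAt_exp_smul_const A s).clm_apply (hasDerivAt_const s x) |>.congr_deriv (by simp [hU])
  have hconst : ∀ s, ∫ ω : Metric.sphere (0 : E) 1, h (U s ω) ∂(volume : Measure E).toSphere =
      ∫ ω : Metric.sphere (0 : E) 1, h ω ∂(volume : Measure E).toSphere := fun s =>
    integral_toSphere_comp_linearIsometryEquiv (Unitary.linearIsometryEquiv ⟨U s, hu s⟩) h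
      hh.continuous
  have hdc : Continuous (fderiv ℝ h) := hh.continuous_fderiv one_ne_zero
  obtain ⟨C, hC⟩ := (isCompact_closedBall (0 : E) 1).exists_bound_of_continuousOn hdc.continuousOn
  have key := hasDerivAt_integral_of_dominated_loc_of_deriv_le
    (μ := (volume : Measure E).toSphere) (x₀ := (0 : ℝ)) (s := Set.univ)
    (F := fun s (ω : Metric.sphere (0 : E) 1) => h (U s ω))
    (F' := fun s (ω : Metric.sphere (0 : E) 1) => fderiv ℝ h (U s ω) (U s (A ω)))
    (bound := fun _ => C * ‖A‖) Filter.univ_mem ?_ ?_ ?_ ?_ ?_ ?_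
  · have h0 : HasDerivAt (fun s => ∫ ω : Metric.sphere (0 : E) 1, h (U s ω)
        ∂(volume : Measure E).toSphere) 0 0 := by
      simp only [hconst]; exact hasDerivAt_const _ _
    simpa [hU] using key.2.unique h0
  · exact .of_forall fun s => (hh.continuous.comp
      ((U s).continuous.comp continuous_subtype_val)).aestronglyMeasurable
  · exact (hh.continuous.comp
      ((U 0).continuous.comp continuous_subtype_val)).integrable_of_hasCompactSupport
      (HasCompactSupport.of_compactSpace _)
  · exact ((hdc.comp ((U 0).continuous.comp continuous_subtype_val)).clm_apply
      ((U 0).continuous.comp (A.continuous.comp continuous_subtype_val))).aestronglyMeasurable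
  · refine .of_forall fun ω s _ => ?_
    have h1 := hC (U s ω) (by simp [hUn])
    calc _ ≤ ‖fderiv ℝ h (U s ω)‖ * ‖U s (A ω)‖ := ContinuousLinearMap.le_opNorm _ _
      _ ≤ C * ‖A‖ := by
        rw [hUn]
        gcongr
        · exact (norm_nonneg _).trans h1
        · simpa using A.le_opNorm (ω : E)
  · exact integrable_const _
  · exact .of_forall fun ω s _ =>
      ((hh.differentiable one_ne_zero _).hasFDerivAt.comp_hasDerivAt s (hd s ω))

end Sphere

theorem laplacian_eq_sum_fderiv_fderiv {n : ℕ} (h : EuclideanSpace ℝ (Fin n) → ℝ)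
    (x : EuclideanSpace ℝ (Fin n)) :
    Laplacian.laplacian h x = ∑ i, fderiv ℝ (fderiv ℝ h) x (EuclideanSpace.single i 1)
      (EuclideanSpace.single i 1) := by
  rw [InnerProductSpace.laplacian_eq_iteratedFDeriv_orthonormalBasis h
    (EuclideanSpace.basisFun (Fin n) ℝ)]
  simp [iteratedFDeriv_two_apply]

/-- The generator of the rotations in the plane of the coordinates `i` and `j`. -/
noncomputable def planeRotationGenerator {n : ℕ} (i j : Fin n) :
    EuclideanSpace ℝ (Fin n) →L[ℝ] EuclideanSpace ℝ (Fin n) :=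
  (EuclideanSpace.proj i).smulRight (EuclideanSpace.single j 1) -
    (EuclideanSpace.proj j).smulRight (EuclideanSpace.single i 1)

theorem planeRotationGenerator_apply {n : ℕ} (i j : Fin n) (x : EuclideanSpace ℝ (Fin n)) :
    planeRotationGenerator i j x =
      x i • EuclideanSpace.single j (1 : ℝ) - x j • EuclideanSpace.single i (1 : ℝ) := by
  simp [planeRotationGenerator]

theorem planeRotationGenerator_mem_skewAdjoint {n : ℕ} (i j : Fin n) :
    planeRotationGenerator i j ∈
      skewAdjoint (EuclideanSpace ℝ (Fin n) →L[ℝ] EuclideanSpace ℝ (Fin n)) := by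
  rw [skewAdjoint.mem_iff, ContinuousLinearMap.star_eq_adjoint, eq_comm,
    ContinuousLinearMap.eq_adjoint_iff]
  intro x y
  simp only [neg_apply, planeRotationGenerator_apply, inner_neg_left,
    inner_sub_left, inner_sub_right, real_inner_smul_left, real_inner_smul_right,
    EuclideanSpace.inner_single_left, EuclideanSpace.inner_single_right]
  simp
  ring

theorem EuclideanSpace.sum_smul_single {n : ℕ} (w : EuclideanSpace ℝ (Fin n)) :
    ∑ i, w i • EuclideanSpace.single i (1 : ℝ) = w := by
  simpa using (EuclideanSpace.basisFun (Fin n) ℝ).sum_repr w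

theorem sum_planeRotationGenerator_apply_apply {n : ℕ} (w : EuclideanSpace ℝ (Fin n)) :
    ∑ i, ∑ j, planeRotationGenerator i j (planeRotationGenerator i j w) =
      (-2 * ((n : ℝ) - 1)) • w := by
  have hterm (i j : Fin n) : planeRotationGenerator i j (planeRotationGenerator i j w) =
      (if i = j then 2 • w i • EuclideanSpace.single i (1 : ℝ) else 0)
        - w j • EuclideanSpace.single j (1 : ℝ) - w i • EuclideanSpace.single i (1 : ℝ) := by
    rcases eq_or_ne i j with rfl | hij
    · simp only [planeRotationGenerator_apply]
      simp
      module
    · simp only [planeRotationGenerator_apply]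
      simp [hij, hij.symm]
  simp only [hterm, Finset.sum_sub_distrib, Finset.sum_ite_eq, Finset.mem_univ, if_true,
    Finset.sum_const, Finset.card_univ, Fintype.card_fin, ← Finset.smul_sum,
    EuclideanSpace.sum_smul_single]
  simp only [← Nat.cast_smul_eq_nsmul ℝ]
  push_cast
  module

theorem sum_bilin_planeRotationGenerator {n : ℕ}
    (B : EuclideanSpace ℝ (Fin n) →L[ℝ] EuclideanSpace ℝ (Fin n) →L[ℝ] ℝ)
    (w : EuclideanSpace ℝ (Fin n)) :
    ∑ i, ∑ j, B (planeRotationGenerator i j w) (planeRotationGenerator i j w) =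
      2 * (‖w‖ ^ 2 * ∑ i, B (EuclideanSpace.single i 1) (EuclideanSpace.single i 1) - B w w) := by
  have hB : B w w = ∑ i, ∑ j,
      w i * w j * B (EuclideanSpace.single i 1) (EuclideanSpace.single j 1) := by
    conv_lhs => rw [← EuclideanSpace.sum_smul_single w]
    simp only [map_sum, map_smul, sum_apply, smul_apply, smul_eq_mul,
      Finset.mul_sum]
    rw [Finset.sum_comm]
    exact Finset.sum_congr rfl fun i _ => Finset.sum_congr rfl fun j _ => by ring
  have hB' : B w w = ∑ i, ∑ j,
      w i * w j * B (EuclideanSpace.single j 1) (EuclideanSpace.single i 1) := by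
    rw [hB, Finset.sum_comm]
    simp only [mul_comm]
  have hnorm : ‖w‖ ^ 2 = ∑ i, w i ^ 2 := EuclideanSpace.real_norm_sq_eq w
  have hterm (i j : Fin n) : B (planeRotationGenerator i j w) (planeRotationGenerator i j w) =
      w i ^ 2 * B (EuclideanSpace.single j 1) (EuclideanSpace.single j 1)
        + w j ^ 2 * B (EuclideanSpace.single i 1) (EuclideanSpace.single i 1)
        - w i * w j * B (EuclideanSpace.single i 1) (EuclideanSpace.single j 1)
        - w i * w j * B (EuclideanSpace.single j 1) (EuclideanSpace.single i 1) := by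
    simp only [planeRotationGenerator_apply, map_sub, map_smul, sub_apply, smul_apply, smul_eq_mul]
    ring
  simp only [hterm, Finset.sum_sub_distrib, Finset.sum_add_distrib, ← hB, ← hB', ← Finset.mul_sum,
    ← Finset.sum_mul, ← hnorm]
  ring

/-- The Laplace–Beltrami operator of the unit sphere, written through the Euclidean derivatives of
a function on the ambient space, has integral zero. -/
theorem integral_toSphere_laplaceBeltrami {n : ℕ} (h : EuclideanSpace ℝ (Fin n) → ℝ)
    (hh : ContDiff ℝ 2 h) :
    ∫ ω : Metric.sphere (0 : EuclideanSpace ℝ (Fin n)) 1,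
      (Laplacian.laplacian h (ω : EuclideanSpace ℝ (Fin n)) -
        fderiv ℝ (fderiv ℝ h) ω ω ω - (n - 1) * fderiv ℝ h ω ω)
      ∂(volume : Measure (EuclideanSpace ℝ (Fin n))).toSphere = 0 := by
  have h1 : ContDiff ℝ 1 (fderiv ℝ h) := hh.fderiv_right le_rfl
  have hd2 : Continuous (fderiv ℝ (fderiv ℝ h)) := h1.continuous_fderiv one_ne_zero
  -- Apply infinitesimal invariance to `x ↦ Dh(x)(A x)`, itself a derivative along `A`.
  have hA (i j : Fin n) : (∫ ω : Metric.sphere (0 : EuclideanSpace ℝ (Fin n)) 1,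
      (fderiv ℝ (fderiv ℝ h) ω (planeRotationGenerator i j ω) (planeRotationGenerator i j ω) +
        fderiv ℝ h ω (planeRotationGenerator i j (planeRotationGenerator i j ω)))
      ∂(volume : Measure (EuclideanSpace ℝ (Fin n))).toSphere) = 0 := by
    have := integral_toSphere_fderiv_skewAdjoint _ (planeRotationGenerator_mem_skewAdjoint i j)
      (fun x => fderiv ℝ h x (planeRotationGenerator i j x))
      (h1.clm_apply (planeRotationGenerator i j).contDiff)
    rw [← this]
    refine integral_congr_ae (.of_forall fun ω => ?_)
    have hd : HasFDerivAt (fun x => fderiv ℝ h x (planeRotationGenerator i j x)) _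
        (ω : EuclideanSpace ℝ (Fin n)) :=
      ((h1.differentiable one_ne_zero _).hasFDerivAt).clm_apply
        (planeRotationGenerator i j).hasFDerivAt
    simp only [hd.fderiv]
    simp [add_comm]
  have hint (A : EuclideanSpace ℝ (Fin n) →L[ℝ] EuclideanSpace ℝ (Fin n)) :
      Integrable (fun ω : Metric.sphere (0 : EuclideanSpace ℝ (Fin n)) 1 =>
        fderiv ℝ (fderiv ℝ h) ω (A ω) (A ω) + fderiv ℝ h ω (A (A ω)))
        (volume : Measure (EuclideanSpace ℝ (Fin n))).toSphere := by
    refine Continuous.integrable_of_hasCompactSupport ?_ (HasCompactSupport.of_compactSpace _)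
    have hc := h1.continuous
    fun_prop
  have hsum : (∫ ω : Metric.sphere (0 : EuclideanSpace ℝ (Fin n)) 1, ∑ i, ∑ j,
      (fderiv ℝ (fderiv ℝ h) ω (planeRotationGenerator i j ω) (planeRotationGenerator i j ω) +
        fderiv ℝ h ω (planeRotationGenerator i j (planeRotationGenerator i j ω)))
      ∂(volume : Measure (EuclideanSpace ℝ (Fin n))).toSphere) = 0 := by
    rw [integral_finsetSum _ fun i _ => integrable_finsetSum _ fun j _ => hint _]
    refine Finset.sum_eq_zero fun i _ => ?_
    rw [integral_finsetSum _ fun j _ => hint _]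
    exact Finset.sum_eq_zero fun j _ => hA i j
  -- Each coordinate plane occurs twice in the sum over pairs `(i, j)`.
  rw [← mul_eq_zero_iff_left (two_ne_zero' ℝ), ← integral_const_mul, ← hsum]
  refine integral_congr_ae (.of_forall fun ω => ?_)
  have hw : ‖(ω : EuclideanSpace ℝ (Fin n))‖ = 1 := by simp
  have hL := congrArg (fderiv ℝ h (ω : EuclideanSpace ℝ (Fin n)))
    (sum_planeRotationGenerator_apply_apply (ω : EuclideanSpace ℝ (Fin n)))
  simp only [map_sum, map_smul, smul_eq_mul] at hL
  simp only [Finset.sum_add_distrib, hL, sum_bilin_planeRotationGenerator, hw,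
    laplacian_eq_sum_fderiv_fderiv]
  ring

/-! ### Huygens measures -/

theorem integral_intervalIntegral_comm_of_continuousOn {Y : Type*} [TopologicalSpace Y]
    [SecondCountableTopology Y] [T2Space Y] [MeasurableSpace Y] [BorelSpace Y] (μ : Measure Y)
    [IsFiniteMeasure μ] {K : Set Y} (hK : IsCompact K) (hμ : ∀ᵐ y ∂μ, y ∈ K) {a b : ℝ} (hab : a ≤ b)
    (F : ℝ → Y → ℝ) (hF : ContinuousOn (fun p : ℝ × Y => F p.1 p.2) (Set.Icc a b ×ˢ K)) :
    ∫ y, (∫ s in a..b, F s y) ∂μ = ∫ s in a..b, (∫ y, F s y ∂μ) := by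
  have hμK : μ.restrict K = μ := Measure.restrict_eq_self_of_ae_mem hμ
  have hint : Integrable (fun p : ℝ × Y => F p.1 p.2) ((volume.restrict (Set.Ioc a b)).prod μ) := by
    have h1 : IntegrableOn (fun p : ℝ × Y => F p.1 p.2) (Set.Icc a b ×ˢ K)
        ((volume : Measure ℝ).prod μ) := hF.integrableOn_compact (isCompact_Icc.prod hK)
    rw [IntegrableOn, ← Measure.prod_restrict, hμK,
      Measure.restrict_congr_set (Ioc_ae_eq_Icc (a := a) (b := b)).symm] at h1
    exact h1
  simp only [intervalIntegral.integral_of_le hab]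
  exact (integral_integral_swap hint).symm

section Affine

variable {n : ℕ} {φ : EuclideanSpace ℝ (Fin n) → ℝ}

theorem fderiv_comp_add_smul (hφ : ContDiff ℝ 2 φ) (x z : EuclideanSpace ℝ (Fin n)) (r : ℝ) :
    fderiv ℝ (fun z => φ (x + r • z)) z = r • fderiv ℝ φ (x + r • z) := by
  have h1 : HasFDerivAt (fun z : EuclideanSpace ℝ (Fin n) => x + r • z)
      (r • ContinuousLinearMap.id ℝ _) z := ((hasFDerivAt_id z).const_smul r).const_add x
  have h2 := ((hφ.differentiable two_ne_zero (x + r • z)).hasFDerivAt.comp z h1).fderiv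
  simp only [Function.comp_def] at h2
  rw [h2]
  ext v
  simp

theorem fderiv_fderiv_comp_add_smul (hφ : ContDiff ℝ 2 φ) (x z : EuclideanSpace ℝ (Fin n)) (r : ℝ) :
    fderiv ℝ (fderiv ℝ (fun z => φ (x + r • z))) z =
      r ^ 2 • fderiv ℝ (fderiv ℝ φ) (x + r • z) := by
  have h1 : HasFDerivAt (fun z : EuclideanSpace ℝ (Fin n) => x + r • z)
      (r • ContinuousLinearMap.id ℝ _) z := ((hasFDerivAt_id z).const_smul r).const_add x
  have h2 : ContDiff ℝ 1 (fderiv ℝ φ) := hφ.fderiv_right le_rfl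
  have h3 : HasFDerivAt (fun z => r • fderiv ℝ φ (x + r • z)) _ z :=
    ((h2.differentiable one_ne_zero (x + r • z)).hasFDerivAt.comp z h1).const_smul r
  rw [funext fun z => fderiv_comp_add_smul hφ x z r, h3.fderiv]
  ext v w
  simp
  ring

theorem laplacian_comp_add_smul (hφ : ContDiff ℝ 2 φ) (x z : EuclideanSpace ℝ (Fin n)) (r : ℝ) :
    Laplacian.laplacian (fun z => φ (x + r • z)) z = r ^ 2 * Laplacian.laplacian φ (x + r • z) := by
  simp [laplacian_eq_sum_fderiv_fderiv, fderiv_fderiv_comp_add_smul hφ, Finset.mul_sum]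

end Affine

/-- A measure carried by the closed unit ball that annihilates
`D²h(z)(z, z) + 2 Dh(z) z - Δh(z)` for every `C²` function `h`. Averaging the Cauchy data
against it over the base of a backward light cone gives the value of a free wave at the apex. -/
structure IsHuygensMeasure {n : ℕ} (m : Measure (EuclideanSpace ℝ (Fin n))) : Prop where
  norm_le_one : ∀ᵐ z ∂m, ‖z‖ ≤ 1
  integral_eq_zero : ∀ h : EuclideanSpace ℝ (Fin n) → ℝ, ContDiff ℝ 2 h →
    ∫ z, (fderiv ℝ (fderiv ℝ h) z z z + 2 * fderiv ℝ h z z - Laplacian.laplacian h z) ∂m = 0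

/-! ### Free waves along backward cones -/

section Representation

variable {n : ℕ} {f g : EuclideanSpace ℝ (Fin n) → ℝ} {u : EuclideanSpace ℝ (Fin n) → ℝ → ℝ}

local notation "E" => EuclideanSpace ℝ (Fin n)

/-- The spacetime derivative of `u`, one-sided at the initial time. -/
noncomputable def spacetimeFDeriv (u : E → ℝ → ℝ) : E × ℝ → (E × ℝ →L[ℝ] ℝ) :=
  fderivWithin ℝ (fun p : E × ℝ => u p.1 p.2) (Set.univ ×ˢ Set.Ici 0)

/-- The second spacetime derivative of `u`, one-sided at the initial time. -/
noncomputable def spacetimeFDeriv₂ (u : E → ℝ → ℝ) :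
    E × ℝ → (E × ℝ →L[ℝ] E × ℝ →L[ℝ] ℝ) :=
  fderivWithin ℝ (spacetimeFDeriv u) (Set.univ ×ˢ Set.Ici 0)

theorem uniqueDiffOn_univ_prod_Ici :
    UniqueDiffOn ℝ (Set.univ ×ˢ Set.Ici 0 : Set (E × ℝ)) :=
  uniqueDiffOn_univ.prod (uniqueDiffOn_Ici 0)

theorem mapsTo_prodMk_left {t : ℝ} (ht : 0 ≤ t) :
    Set.MapsTo (fun y : E => ((y, t) : E × ℝ)) Set.univ (Set.univ ×ˢ Set.Ici 0) :=
  fun _ _ => ⟨trivial, ht⟩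

theorem mapsTo_prodMk_right (y : E) :
    Set.MapsTo (fun s : ℝ => ((y, s) : E × ℝ)) (Set.Ici 0) (Set.univ ×ˢ Set.Ici 0) :=
  fun _ hs => ⟨trivial, hs⟩

namespace IsFreeWaveSolution

theorem contDiffOn_spacetimeFDeriv (hu : IsFreeWaveSolution f g u) :
    ContDiffOn ℝ 1 (spacetimeFDeriv u) (Set.univ ×ˢ Set.Ici 0) :=
  hu.contDiffOn.fderivWithin uniqueDiffOn_univ_prod_Ici le_rfl

theorem continuousOn_spacetimeFDeriv₂ (hu : IsFreeWaveSolution f g u) :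
    ContinuousOn (spacetimeFDeriv₂ u) (Set.univ ×ˢ Set.Ici 0) :=
  hu.contDiffOn_spacetimeFDeriv.continuousOn_fderivWithin uniqueDiffOn_univ_prod_Ici le_rfl

theorem hasFDerivWithinAt (hu : IsFreeWaveSolution f g u) {p : E × ℝ} (hp : 0 ≤ p.2) :
    HasFDerivWithinAt (fun p : E × ℝ => u p.1 p.2) (spacetimeFDeriv u p)
      (Set.univ ×ˢ Set.Ici 0) p :=
  (hu.contDiffOn.differentiableOn two_ne_zero p ⟨trivial, hp⟩).hasFDerivWithinAt

theorem hasFDerivWithinAt₂ (hu : IsFreeWaveSolution f g u) {p : E × ℝ} (hp : 0 ≤ p.2) :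
    HasFDerivWithinAt (spacetimeFDeriv u) (spacetimeFDeriv₂ u p) (Set.univ ×ˢ Set.Ici 0) p :=
  (hu.contDiffOn_spacetimeFDeriv.differentiableOn one_ne_zero p ⟨trivial, hp⟩).hasFDerivWithinAt

theorem hasFDerivAt_space (hu : IsFreeWaveSolution f g u) {t : ℝ} (ht : 0 ≤ t) (y : E) :
    HasFDerivAt (fun y => u y t) ((spacetimeFDeriv u (y, t)).comp (.inl ℝ E ℝ)) y := by
  rw [← hasFDerivWithinAt_univ]
  exact HasFDerivWithinAt.comp (f := fun y : E => (y, t)) (g := fun p : E × ℝ => u p.1 p.2) y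
    (hu.hasFDerivWithinAt (p := (y, t)) ht) (hasFDerivAt_prodMk_left y t).hasFDerivWithinAt
    (mapsTo_prodMk_left ht)

theorem fderiv_space (hu : IsFreeWaveSolution f g u) {t : ℝ} (ht : 0 ≤ t) (y : E) :
    fderiv ℝ (fun y => u y t) y = (spacetimeFDeriv u (y, t)).comp (.inl ℝ E ℝ) :=
  (hu.hasFDerivAt_space ht y).fderiv

theorem fderiv_fderiv_space (hu : IsFreeWaveSolution f g u) {t : ℝ} (ht : 0 ≤ t) (y v w : E) :
    fderiv ℝ (fderiv ℝ (fun y => u y t)) y v w = spacetimeFDeriv₂ u (y, t) (v, 0) (w, 0) := by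
  have h : HasFDerivAt (fun y => spacetimeFDeriv u (y, t))
      ((spacetimeFDeriv₂ u (y, t)).comp (.inl ℝ E ℝ)) y := by
    rw [← hasFDerivWithinAt_univ]
    exact HasFDerivWithinAt.comp (f := fun y : E => (y, t)) (g := spacetimeFDeriv u) y
      (hu.hasFDerivWithinAt₂ (p := (y, t)) ht) (hasFDerivAt_prodMk_left y t).hasFDerivWithinAt
      (mapsTo_prodMk_left ht)
  rw [funext fun y => hu.fderiv_space ht y, (h.clm_comp (hasFDerivAt_const _ _)).fderiv]
  simp

theorem contDiff_space (hu : IsFreeWaveSolution f g u) {t : ℝ} (ht : 0 ≤ t) :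
    ContDiff ℝ 2 (fun y => u y t) := by
  rw [← contDiffOn_univ]
  exact ContDiffOn.comp (f := fun y : E => (y, t)) (g := fun p : E × ℝ => u p.1 p.2)
    hu.contDiffOn (contDiff_prodMk_left t).contDiffOn (mapsTo_prodMk_left ht)

theorem derivWithin_time (hu : IsFreeWaveSolution f g u) {t : ℝ} (ht : 0 ≤ t) (y : E) :
    derivWithin (fun s => u y s) (Set.Ici 0) t = spacetimeFDeriv u (y, t) (0, 1) := by
  have h := HasFDerivWithinAt.comp_hasDerivWithinAt (f := fun s : ℝ => ((y, s) : E × ℝ)) t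
    (hu.hasFDerivWithinAt (p := (y, t)) ht)
    ((hasDerivAt_const t y).prodMk (hasDerivAt_id t)).hasDerivWithinAt (mapsTo_prodMk_right y)
  exact h.derivWithin (uniqueDiffOn_Ici 0 t ht)

theorem iteratedDerivWithin_two_time (hu : IsFreeWaveSolution f g u) {t : ℝ} (ht : 0 ≤ t) (y : E) :
    iteratedDerivWithin 2 (fun s => u y s) (Set.Ici 0) t =
      spacetimeFDeriv₂ u (y, t) (0, 1) (0, 1) := by
  have h := HasFDerivWithinAt.comp_hasDerivWithinAt (f := fun s : ℝ => ((y, s) : E × ℝ)) t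
    (hu.hasFDerivWithinAt₂ (p := (y, t)) ht)
    ((hasDerivAt_const t y).prodMk (hasDerivAt_id t)).hasDerivWithinAt (mapsTo_prodMk_right y)
  have h' := (h.clm_apply (hasDerivWithinAt_const t _ ((0, 1) : E × ℝ))).derivWithin
    (uniqueDiffOn_Ici 0 t ht)
  rw [iteratedDerivWithin_succ]
  rw [derivWithin_congr (f := fun s => spacetimeFDeriv u (y, s) (0, 1))]
  · simpa using! h'
  · intro s hs
    rw [iteratedDerivWithin_one]
    exact hu.derivWithin_time hs y
  · rw [iteratedDerivWithin_one]
    exact hu.derivWithin_time ht y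

theorem laplacian_space (hu : IsFreeWaveSolution f g u) {t : ℝ} (ht : 0 ≤ t) (y : E) :
    Laplacian.laplacian (fun y => u y t) y = spacetimeFDeriv₂ u (y, t) (0, 1) (0, 1) := by
  rw [← hu.iteratedDerivWithin_two_time ht]
  linarith [hu.wave_eq y t ht]

theorem spacetimeFDeriv₂_symm (hu : IsFreeWaveSolution f g u) {p : E × ℝ} (hp : 0 < p.2)
    (v w : E × ℝ) :
    spacetimeFDeriv₂ u p v w = spacetimeFDeriv₂ u p w v := by
  have hnhds : ∀ᶠ q in nhds p, 0 < q.2 := continuous_snd.continuousAt.eventually (lt_mem_nhds hp)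
  refine second_derivative_symmetric_of_eventually (x := p) (f := fun p : E × ℝ => u p.1 p.2)
    (f' := spacetimeFDeriv u) ?_ ?_ v w
  · filter_upwards [hnhds] with q hq
    exact (hu.hasFDerivWithinAt hq.le).hasFDerivAt
      (prod_mem_nhds Filter.univ_mem (Ici_mem_nhds hq))
  · exact (hu.hasFDerivWithinAt₂ hp.le).hasFDerivAt
      (prod_mem_nhds Filter.univ_mem (Ici_mem_nhds hp))

/-- The derivative of `u + r (∂_z u + ∂_t u)` along the backward characteristic
`r ↦ (x + r z, t - r)`. The first-order terms in `∂_t u` and all mixed second derivatives cancel. -/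
theorem hasDerivAt_along_cone (hu : IsFreeWaveSolution f g u) (x z : E) {t r : ℝ} (hr : r < t) :
    HasDerivAt (fun r => u (x + r • z) (t - r) +
        r * spacetimeFDeriv u (x + r • z, t - r) (z, 1))
      (2 * spacetimeFDeriv u (x + r • z, t - r) (z, 0) +
        r * (spacetimeFDeriv₂ u (x + r • z, t - r) (z, 0) (z, 0) -
          spacetimeFDeriv₂ u (x + r • z, t - r) (0, 1) (0, 1))) r := by
  have htr : 0 < t - r := sub_pos.2 hr
  have hS : (Set.univ ×ˢ Set.Ici 0 : Set (E × ℝ)) ∈ nhds (x + r • z, t - r) :=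
    prod_mem_nhds Filter.univ_mem (Ici_mem_nhds htr)
  have hγ : HasDerivAt (fun r : ℝ => ((x + r • z, t - r) : E × ℝ)) (z, -1) r := by
    have h1 := ((hasDerivAt_id r).smul_const z).const_add x
    have h2 := (hasDerivAt_id r).const_sub t
    simpa using! h1.prodMk h2
  have hU := ((hu.hasFDerivWithinAt (p := (x + r • z, t - r)) htr.le).hasFDerivAt hS).comp_hasDerivAt
    r hγ
  have hD := ((hu.hasFDerivWithinAt₂ (p := (x + r • z, t - r)) htr.le).hasFDerivAt hS).comp_hasDerivAt
    r hγ
  have key := hU.add ((hasDerivAt_id r).mul (hD.clm_apply (hasDerivAt_const r ((z, 1) : E × ℝ))))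
  refine key.congr_deriv ?_
  have e1 : ((z, 1) : E × ℝ) = (z, 0) + (0, 1) := by simp
  have e2 : ((z, -1) : E × ℝ) = (z, 0) - (0, 1) := by simp
  have hs := hu.spacetimeFDeriv₂_symm (p := (x + r • z, t - r)) htr (z, 0) (0, 1)
  simp only [e1, e2, Function.comp_apply, id, map_add, map_sub, sub_apply, map_zero]
  linear_combination r * hs

end IsFreeWaveSolution

/-- A Huygens average of the Cauchy data over the ball of radius `t` about `x` represents the
solution at `(x, t)`. -/
theorem IsHuygensMeasure.integral_data_eq {m : Measure E} [IsFiniteMeasure m]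
    (hm : IsHuygensMeasure m) (hu : IsFreeWaveSolution f g u) (x : E) {t : ℝ} (ht : 0 < t) :
    ∫ z, (f (x + t • z) + t * (fderiv ℝ f (x + t • z) z + g (x + t • z))) ∂m =
      m.real Set.univ * u x t := by
  set F : ℝ → E → ℝ := fun r z => u (x + r • z) (t - r) +
    r * spacetimeFDeriv u (x + r • z, t - r) (z, 1) with hF
  set G : ℝ → E → ℝ := fun r z => 2 * spacetimeFDeriv u (x + r • z, t - r) (z, 0) +
        r * (spacetimeFDeriv₂ u (x + r • z, t - r) (z, 0) (z, 0) -
          spacetimeFDeriv₂ u (x + r • z, t - r) (0, 1) (0, 1)) with hG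
  have hγ : ContinuousOn (fun p : ℝ × E => ((x + p.1 • p.2, t - p.1) : E × ℝ))
      (Set.Icc 0 t ×ˢ Set.univ) := by fun_prop
  have hmaps : Set.MapsTo (fun p : ℝ × E => ((x + p.1 • p.2, t - p.1) : E × ℝ))
      (Set.Icc 0 t ×ˢ Set.univ) (Set.univ ×ˢ Set.Ici 0) :=
    fun p hp => ⟨trivial, sub_nonneg.2 hp.1.2⟩
  have cU := hu.contDiffOn.continuousOn.comp hγ hmaps
  have cD := hu.contDiffOn_spacetimeFDeriv.continuousOn.comp hγ hmaps
  have cD2 := hu.continuousOn_spacetimeFDeriv₂.comp hγ hmaps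
  have c10 : ContinuousOn (fun p : ℝ × E => ((p.2, 0) : E × ℝ)) (Set.Icc 0 t ×ˢ Set.univ) := by
    fun_prop
  have c11 : ContinuousOn (fun p : ℝ × E => ((p.2, 1) : E × ℝ)) (Set.Icc 0 t ×ˢ Set.univ) := by
    fun_prop
  have c01 : ContinuousOn (fun _ : ℝ × E => ((0, 1) : E × ℝ)) (Set.Icc 0 t ×ˢ Set.univ) := by
    fun_prop
  have cF : ContinuousOn (fun p : ℝ × E => F p.1 p.2) (Set.Icc 0 t ×ˢ Set.univ) :=
    cU.add (continuousOn_fst.mul (cD.clm_apply c11))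
  have cG : ContinuousOn (fun p : ℝ × E => G p.1 p.2) (Set.Icc 0 t ×ˢ Set.univ) :=
    ((continuousOn_const (c := (2 : ℝ))).mul (cD.clm_apply c10)).add (continuousOn_fst.mul
      (((cD2.clm_apply c10).clm_apply c10).sub ((cD2.clm_apply c01).clm_apply c01)))
  have slice (H : ℝ → E → ℝ)
      (cH : ContinuousOn (fun p : ℝ × E => H p.1 p.2) (Set.Icc 0 t ×ˢ Set.univ)) (z : E) :
      ContinuousOn (fun r => H r z) (Set.Icc 0 t) :=
    cH.comp (f := fun r => (r, z)) (by fun_prop) fun r hr => ⟨hr, trivial⟩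
  have hFTC (z : E) : ∫ r in (0 : ℝ)..t, G r z = F t z - F 0 z := by
    refine intervalIntegral.integral_eq_sub_of_hasDerivAt_of_le ht.le (slice F cF z)
      (fun r hr => hu.hasDerivAt_along_cone x z hr.2) ?_
    exact (slice G cG z).intervalIntegrable_of_Icc ht.le
  have hzero : ∀ r ∈ Set.Ioc 0 t, ∫ z, G r z ∂m = 0 := by
    intro r hr
    have htr : 0 ≤ t - r := sub_nonneg.2 hr.2
    have hc := hu.contDiff_space htr
    have := hm.integral_eq_zero (fun z => u (x + r • z) (t - r))
      (hc.comp (contDiff_const.add (contDiff_const_smul r)))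
    -- The identity for `z ↦ u(x + r z, t - r)` is `r` times the one for `G r`.
    rw [← mul_right_inj' hr.1.ne', mul_zero, ← integral_const_mul, ← this]
    refine integral_congr_ae (.of_forall fun z => ?_)
    simp only [fderiv_fderiv_comp_add_smul hc x z r, fderiv_comp_add_smul hc x z r,
      laplacian_comp_add_smul hc x z r, smul_apply, hu.laplacian_space htr,
      hu.fderiv_fderiv_space htr, hu.fderiv_space htr, hG, smul_eq_mul]
    simp
    ring
  have hswap := integral_intervalIntegral_comm_of_continuousOn m (isCompact_closedBall (0 : E) 1)
    (by simpa using hm.norm_le_one) ht.le G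
    (cG.mono (Set.prod_mono_right (Set.subset_univ _)))
  rw [intervalIntegral.integral_zero_ae (.of_forall fun r hr => hzero r
    (by rwa [Set.uIoc_of_le ht.le] at hr))] at hswap
  have cFt (r : ℝ) (hr : r ∈ Set.Icc 0 t) : Continuous (F r) := by
    rw [← continuousOn_univ]
    exact cF.comp (f := fun z => (r, z)) (by fun_prop) fun z _ => ⟨hr, trivial⟩
  have hint (r : ℝ) (hr : r ∈ Set.Icc 0 t) : Integrable (F r) m := by
    have h1 := (cFt r hr).continuousOn.integrableOn_compact (μ := m) (isCompact_closedBall (0 : E) 1)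
    rwa [IntegrableOn, Measure.restrict_eq_self_of_ae_mem (by simpa using hm.norm_le_one)] at h1
  have h0 : (0 : ℝ) ∈ Set.Icc 0 t := ⟨le_rfl, ht.le⟩
  have h1 : t ∈ Set.Icc 0 t := ⟨ht.le, le_rfl⟩
  simp only [hFTC] at hswap
  rw [integral_sub (hint t h1) (hint 0 h0), sub_eq_zero] at hswap
  have hF0 : ∫ z, F 0 z ∂m = m.real Set.univ * u x t := by simp [hF]
  rw [← hF0, ← hswap]
  -- On the initial slice the one-sided derivatives of `u` are the Cauchy data.
  refine integral_congr_ae (.of_forall fun z => ?_)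
  have hf : (fun y => u y 0) = f := funext hu.initial_position
  have e1 : ((z, 1) : E × ℝ) = (z, 0) + (0, 1) := by simp
  have hfd := hu.fderiv_space le_rfl (x + t • z)
  have hgd := hu.derivWithin_time le_rfl (x + t • z)
  rw [hf] at hfd
  rw [hu.initial_velocity] at hgd
  simp only [hF, hfd, hgd, sub_self, hu.initial_position]
  rw [e1, map_add]
  simp

end Representation

/-! ### The two Huygens measures -/

/-- The surface measure of the unit sphere, as a measure on the ambient space. -/
noncomputable def surfaceMeasure (n : ℕ) : Measure (EuclideanSpace ℝ (Fin n)) :=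
  (volume : Measure (EuclideanSpace ℝ (Fin n))).toSphere.map (↑)

instance (n : ℕ) : IsFiniteMeasure (surfaceMeasure n) := by
  unfold surfaceMeasure; infer_instance

theorem integral_surfaceMeasure {n : ℕ} (φ : EuclideanSpace ℝ (Fin n) → ℝ) :
    ∫ z, φ z ∂surfaceMeasure n = ∫ ω : Metric.sphere (0 : EuclideanSpace ℝ (Fin n)) 1, φ ω
      ∂(volume : Measure (EuclideanSpace ℝ (Fin n))).toSphere :=
  (MeasurableEmbedding.subtype_coe Metric.isClosed_sphere.measurableSet).integral_map φ

theorem isHuygensMeasure_surfaceMeasure : IsHuygensMeasure (surfaceMeasure 3) where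
  norm_le_one := by
    rw [surfaceMeasure, (MeasurableEmbedding.subtype_coe
      Metric.isClosed_sphere.measurableSet).ae_map_iff]
    exact .of_forall fun ω => by simp
  integral_eq_zero h hh := by
    rw [integral_surfaceMeasure, ← neg_eq_zero, ← integral_neg,
      ← integral_toSphere_laplaceBeltrami h hh]
    refine integral_congr_ae (.of_forall fun ω => ?_)
    push_cast
    ring

/-- The measure `dz / √(1 - |z|²)` on the unit disc. In polar coordinates `z = ρ ω` with
`ρ = sin θ` its density becomes `sin θ dθ dS_ω`, which is bounded. -/
noncomputable def discMeasure : Measure (EuclideanSpace ℝ (Fin 2)) :=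
  (((volume.restrict (Set.Ioc 0 (Real.pi / 2))).withDensity
    fun θ => ENNReal.ofReal (Real.sin θ)).prod
      (volume : Measure (EuclideanSpace ℝ (Fin 2))).toSphere).map
    fun p => Real.sin p.1 • (p.2 : EuclideanSpace ℝ (Fin 2))

theorem continuous_sin_smul : Continuous
    fun p : ℝ × Metric.sphere (0 : EuclideanSpace ℝ (Fin 2)) 1 =>
      Real.sin p.1 • (p.2 : EuclideanSpace ℝ (Fin 2)) := by
  fun_prop

instance : IsFiniteMeasure ((volume.restrict (Set.Ioc 0 (Real.pi / 2))).withDensity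
    fun θ => ENNReal.ofReal (Real.sin θ)) :=
  isFiniteMeasure_withDensity_ofReal
    (Real.continuous_sin.integrableOn_Ioc (μ := volume)).hasFiniteIntegral

instance : IsFiniteMeasure discMeasure := by
  unfold discMeasure; infer_instance

theorem ae_norm_le_one_discMeasure : ∀ᵐ z ∂discMeasure, ‖z‖ ≤ 1 := by
  rw [discMeasure, ae_map_iff continuous_sin_smul.measurable.aemeasurable
    (measurableSet_le measurable_norm measurable_const)]
  exact .of_forall fun p => by simpa [norm_smul] using Real.abs_sin_le_one p.1

theorem integral_discMeasure (φ : EuclideanSpace ℝ (Fin 2) → ℝ) (hφ : Continuous φ) :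
    ∫ z, φ z ∂discMeasure = ∫ θ in (0 : ℝ)..(Real.pi / 2), Real.sin θ *
      ∫ ω : Metric.sphere (0 : EuclideanSpace ℝ (Fin 2)) 1, φ (Real.sin θ • ω)
        ∂(volume : Measure (EuclideanSpace ℝ (Fin 2))).toSphere := by
  obtain ⟨C, hC⟩ :=
    (isCompact_closedBall (0 : EuclideanSpace ℝ (Fin 2)) 1).exists_bound_of_continuousOn
    hφ.continuousOn
  have hc := hφ.comp continuous_sin_smul
  rw [discMeasure, integral_map continuous_sin_smul.measurable.aemeasurable
    hφ.aestronglyMeasurable, integral_prod, integral_withDensity_eq_integral_toReal_smul,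
    intervalIntegral.integral_of_le (by positivity)]
  · refine setIntegral_congr_fun measurableSet_Ioc fun θ hθ => ?_
    have : 0 ≤ Real.sin θ := Real.sin_nonneg_of_nonneg_of_le_pi hθ.1.le
      (by linarith [hθ.2, Real.pi_pos])
    simp [ENNReal.toReal_ofReal this]
  · exact (ENNReal.continuous_ofReal.comp Real.continuous_sin).measurable
  · exact .of_forall fun _ => ENNReal.ofReal_lt_top
  · refine Integrable.of_bound hc.aestronglyMeasurable C (.of_forall fun p => hC _ ?_)
    simpa [norm_smul] using Real.abs_sin_le_one p.1

/-- Integration by parts in the radial variable `sin θ`, along a fixed ray of the plane. -/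
theorem hasDerivAt_sin_mul_cos_mul_fderiv {E : Type*} [NormedAddCommGroup E] [NormedSpace ℝ E]
    {h : E → ℝ} (hh : ContDiff ℝ 2 h) (ω : E) (θ : ℝ) :
    HasDerivAt (fun θ => Real.sin θ * Real.cos θ * fderiv ℝ h (Real.sin θ • ω) ω)
      ((1 - 2 * Real.sin θ ^ 2) * fderiv ℝ h (Real.sin θ • ω) ω +
        (Real.sin θ - Real.sin θ ^ 3) * fderiv ℝ (fderiv ℝ h) (Real.sin θ • ω) ω ω) θ := by
  have h1 : ContDiff ℝ 1 (fderiv ℝ h) := hh.fderiv_right le_rfl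
  have hs : HasDerivAt (fun θ => Real.sin θ • ω) (Real.cos θ • ω) θ :=
    (Real.hasDerivAt_sin θ).smul_const ω
  have hD : HasDerivAt (fun θ => fderiv ℝ h (Real.sin θ • ω))
      (fderiv ℝ (fderiv ℝ h) (Real.sin θ • ω) (Real.cos θ • ω)) θ :=
    (h1.differentiable one_ne_zero (Real.sin θ • ω)).hasFDerivAt.comp_hasDerivAt θ hs
  have hd : HasDerivAt (fun θ => fderiv ℝ h (Real.sin θ • ω) ω)
      (Real.cos θ * fderiv ℝ (fderiv ℝ h) (Real.sin θ • ω) ω ω) θ :=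
    (hD.clm_apply (hasDerivAt_const θ ω)).congr_deriv (by simp)
  refine (((Real.hasDerivAt_sin θ).mul (Real.hasDerivAt_cos θ)).mul hd).congr_deriv ?_
  rw [Pi.mul_apply]
  linear_combination (fderiv ℝ h (Real.sin θ • ω) ω +
    Real.sin θ * fderiv ℝ (fderiv ℝ h) (Real.sin θ • ω) ω ω) * Real.cos_sq' θ

/-- The spherical means over the circle of radius `s` satisfy the polar form of the Laplacian. -/
theorem integral_circle_laplacian {h : EuclideanSpace ℝ (Fin 2) → ℝ} (hh : ContDiff ℝ 2 h) {s : ℝ}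
    (hs : 0 < s) :
    ∫ ω : Metric.sphere (0 : EuclideanSpace ℝ (Fin 2)) 1,
      (s * Laplacian.laplacian h (s • (ω : EuclideanSpace ℝ (Fin 2))) -
        s * fderiv ℝ (fderiv ℝ h) (s • (ω : EuclideanSpace ℝ (Fin 2))) ω ω -
        fderiv ℝ h (s • (ω : EuclideanSpace ℝ (Fin 2))) ω)
      ∂(volume : Measure (EuclideanSpace ℝ (Fin 2))).toSphere = 0 := by
  have hLB := integral_toSphere_laplaceBeltrami
    (fun z => h ((0 : EuclideanSpace ℝ (Fin 2)) + s • z))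
    (hh.comp (contDiff_const.add (contDiff_const_smul s)))
  rw [← mul_right_inj' hs.ne', mul_zero, ← hLB, ← integral_const_mul]
  refine integral_congr_ae (.of_forall fun ω => ?_)
  simp only [fderiv_fderiv_comp_add_smul hh, fderiv_comp_add_smul hh,
    laplacian_comp_add_smul hh, smul_apply, smul_eq_mul]
  simp only [zero_add]
  push_cast
  ring

theorem continuous_huygensIntegrand {n : ℕ} {h : EuclideanSpace ℝ (Fin n) → ℝ}
    (hh : ContDiff ℝ 2 h) :
    Continuous fun z => fderiv ℝ (fderiv ℝ h) z z z + 2 * fderiv ℝ h z z -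
      Laplacian.laplacian h z := by
  have h1 : ContDiff ℝ 1 (fderiv ℝ h) := hh.fderiv_right le_rfl
  have cd1 : Continuous (fderiv ℝ h) := h1.continuous
  have cd2 : Continuous (fderiv ℝ (fderiv ℝ h)) := h1.continuous_fderiv one_ne_zero
  simp only [laplacian_eq_sum_fderiv_fderiv]
  fun_prop

/-- Joint continuity of the `θ`-derivative of `sin θ cos θ Dh(sin θ ω) ω`. -/
theorem continuous_polarDerivative {h : EuclideanSpace ℝ (Fin 2) → ℝ} (hh : ContDiff ℝ 2 h) :
    Continuous fun p : ℝ × Metric.sphere (0 : EuclideanSpace ℝ (Fin 2)) 1 =>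
      (1 - 2 * Real.sin p.1 ^ 2) * fderiv ℝ h (Real.sin p.1 • p.2) p.2 +
        (Real.sin p.1 - Real.sin p.1 ^ 3) *
          fderiv ℝ (fderiv ℝ h) (Real.sin p.1 • p.2) p.2 p.2 := by
  have h1 : ContDiff ℝ 1 (fderiv ℝ h) := hh.fderiv_right le_rfl
  have cω : Continuous fun p : ℝ × Metric.sphere (0 : EuclideanSpace ℝ (Fin 2)) 1 =>
    (p.2 : EuclideanSpace ℝ (Fin 2)) := continuous_subtype_val.comp continuous_snd
  have cs : Continuous fun p : ℝ × Metric.sphere (0 : EuclideanSpace ℝ (Fin 2)) 1 =>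
    Real.sin p.1 := Real.continuous_sin.comp continuous_fst
  have c1 := (h1.continuous.comp continuous_sin_smul).clm_apply cω
  have c2 := (((h1.continuous_fderiv one_ne_zero).comp continuous_sin_smul).clm_apply cω).clm_apply
    cω
  exact ((continuous_const.sub (continuous_const.mul (cs.pow 2))).mul c1).add
    ((cs.sub (cs.pow 3)).mul c2)

/-- The boundary terms of `sin θ cos θ Dh(sin θ ω) ω` vanish at the centre and on the unit circle. -/
theorem integral_integral_polarDerivative {h : EuclideanSpace ℝ (Fin 2) → ℝ}
    (hh : ContDiff ℝ 2 h) :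
    ∫ θ in (0 : ℝ)..(Real.pi / 2), (∫ ω : Metric.sphere (0 : EuclideanSpace ℝ (Fin 2)) 1,
      ((1 - 2 * Real.sin θ ^ 2) * fderiv ℝ h (Real.sin θ • ω) ω +
        (Real.sin θ - Real.sin θ ^ 3) * fderiv ℝ (fderiv ℝ h) (Real.sin θ • ω) ω ω)
      ∂(volume : Measure (EuclideanSpace ℝ (Fin 2))).toSphere) = 0 := by
  rw [← integral_intervalIntegral_comm_of_continuousOn _ isCompact_univ
    (.of_forall fun _ => trivial) (by positivity)
    (fun θ (ω : Metric.sphere (0 : EuclideanSpace ℝ (Fin 2)) 1) =>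
      (1 - 2 * Real.sin θ ^ 2) * fderiv ℝ h (Real.sin θ • ω) ω +
        (Real.sin θ - Real.sin θ ^ 3) * fderiv ℝ (fderiv ℝ h) (Real.sin θ • ω) ω ω)
    (continuous_polarDerivative hh).continuousOn]
  refine integral_eq_zero_of_ae (.of_forall fun ω => ?_)
  simp only
  rw [intervalIntegral.integral_eq_sub_of_hasDerivAt
    (fun θ _ => hasDerivAt_sin_mul_cos_mul_fderiv hh (ω : EuclideanSpace ℝ (Fin 2)) θ)
    (((continuous_polarDerivative hh).comp (Continuous.prodMk_left ω)).intervalIntegrable _ _)]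
  simp

/-- In the plane the radial part of the Laplacian must be integrated over the radius as well: with
`P` the circular mean of `Dh(z) ω` at `z = sin θ ω`, the integrand in `θ` equals
`-d/dθ (sin θ cos θ P)` once the angular part has been averaged out. -/
theorem integral_discMeasure_huygensIntegrand {h : EuclideanSpace ℝ (Fin 2) → ℝ}
    (hh : ContDiff ℝ 2 h) :
    ∫ z, (fderiv ℝ (fderiv ℝ h) z z z + 2 * fderiv ℝ h z z - Laplacian.laplacian h z)
      ∂discMeasure = 0 := by
  rw [integral_discMeasure _ (continuous_huygensIntegrand hh), ← neg_eq_zero,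
    ← intervalIntegral.integral_neg]
  refine Eq.trans ?_ (integral_integral_polarDerivative hh)
  refine intervalIntegral.integral_congr_ae (.of_forall fun θ hθ => ?_)
  rw [Set.uIoc_of_le (by positivity)] at hθ
  have hs : 0 < Real.sin θ := Real.sin_pos_of_pos_of_lt_pi hθ.1 (by linarith [hθ.2, Real.pi_pos])
  have cθ : Continuous fun ω : Metric.sphere (0 : EuclideanSpace ℝ (Fin 2)) 1 =>
      ((θ, ω) : ℝ × Metric.sphere (0 : EuclideanSpace ℝ (Fin 2)) 1) := by fun_prop
  have cG := (continuous_polarDerivative hh).comp cθ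
  have cB := (continuous_huygensIntegrand hh).comp (continuous_sin_smul.comp cθ)
  simp only [Function.comp_def] at cG cB
  refine sub_eq_zero.1 (Eq.trans ?_ (integral_circle_laplacian hh hs))
  rw [← integral_const_mul, ← integral_neg, ← integral_sub]
  · refine integral_congr_ae (.of_forall fun ω => ?_)
    simp only [map_smul, smul_apply, smul_eq_mul]
    ring
  · exact ((cB.integrable_of_hasCompactSupport
      (HasCompactSupport.of_compactSpace _)).const_mul (Real.sin θ)).neg
  · exact cG.integrable_of_hasCompactSupport
      (HasCompactSupport.of_compactSpace _)

theorem isHuygensMeasure_discMeasure : IsHuygensMeasure discMeasure where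
  norm_le_one := ae_norm_le_one_discMeasure
  integral_eq_zero _ hh := integral_discMeasure_huygensIntegrand hh

theorem surfaceMeasure_real_univ : (surfaceMeasure 3).real Set.univ = 4 * Real.pi := by
  have h := integral_surfaceMeasure (n := 3) fun _ => 1
  simp only [integral_const, smul_eq_mul, mul_one, Measure.toSphere_real_apply_univ] at h
  rw [h, measureReal_def, EuclideanSpace.volume_ball_fin_three]
  simp
  rw [ENNReal.toReal_ofReal (by positivity)]
  ring

theorem discMeasure_real_univ : discMeasure.real Set.univ = 2 * Real.pi := by
  have h := integral_discMeasure (fun _ => 1) continuous_const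
  simp only [integral_const, smul_eq_mul, mul_one, Measure.toSphere_real_apply_univ] at h
  rw [h, measureReal_def, EuclideanSpace.volume_ball_fin_two]
  simp [Real.pi_nonneg]

/-! ### The lower bound -/

theorem continuous_dataCombination {n : ℕ} {f g : EuclideanSpace ℝ (Fin n) → ℝ}
    (hf : ContDiff ℝ 1 f) (hg : Continuous g) : Continuous (dataCombination f g) := by
  have hgrad : Continuous (gradient f) :=
    (InnerProductSpace.toDual ℝ _).symm.continuous.comp (hf.continuous_fderiv one_ne_zero)
  have hpos (y : EuclideanSpace ℝ (Fin n)) : 1 + ‖y‖ ≠ 0 := by positivity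
  exact ((hf.continuous.div (by fun_prop) hpos).sub hgrad.norm).add hg

/-- Pointwise comparison behind the lower bound: on the base of the cone over a point of `Σ₂` one
has `t ≤ 1 + |y|` and `f(y) > 0`, so that `f(y) ≥ t f(y) / (1 + |y|)`. -/
theorem mul_dataCombination_le {n : ℕ} {f g : EuclideanSpace ℝ (Fin n) → ℝ} {R : ℝ}
    (hf : ∀ y, R ≤ ‖y‖ → 0 < f y) {x z : EuclideanSpace ℝ (Fin n)}
    {t : ℝ} (hxt : (x, t) ∈ sigmaTwo n R) (hz : ‖z‖ ≤ 1) :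
    t * dataCombination f g (x + t • z) ≤
      f (x + t • z) + t * (fderiv ℝ f (x + t • z) z + g (x + t • z)) := by
  obtain ⟨ht, hR⟩ := hxt
  simp only at ht hR
  have htz : ‖t • z‖ ≤ t := by
    rw [norm_smul, Real.norm_of_nonneg ht.le]
    exact mul_le_of_le_one_right ht.le hz
  have hy : ‖x‖ - t ≤ ‖x + t • z‖ := by
    have := norm_sub_le (x + t • z) (t • z)
    rw [add_sub_cancel_right] at this
    linarith
  set y := x + t • z
  have hfy : 0 < f y := hf y ((le_max_left _ _).trans (hR.trans hy))
  have hty : t ≤ 1 + ‖y‖ := by linarith [le_max_right R (t - 1)]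
  have h1 : t * (f y / (1 + ‖y‖)) ≤ f y := by
    rw [← mul_div_assoc, div_le_iff₀ (by positivity), mul_comm]
    exact mul_le_mul_of_nonneg_left hty hfy.le
  have h2 : -‖gradient f y‖ ≤ fderiv ℝ f y z := by
    have h3 : ‖gradient f y‖ = ‖fderiv ℝ f y‖ := LinearIsometryEquiv.norm_map _ _
    have h4 : ‖fderiv ℝ f y z‖ ≤ ‖fderiv ℝ f y‖ :=
      ((fderiv ℝ f y).le_opNorm z).trans (mul_le_of_le_one_right (norm_nonneg _) hz)
    rw [h3]
    exact (abs_le.1 h4).1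
  have h5 := mul_le_mul_of_nonneg_left h2 ht.le
  simp only [dataCombination]
  linarith

theorem IsHuygensMeasure.mul_integral_dataCombination_le {n : ℕ}
    {m : Measure (EuclideanSpace ℝ (Fin n))} [IsFiniteMeasure m] (hm : IsHuygensMeasure m)
    {f g : EuclideanSpace ℝ (Fin n) → ℝ} {R : ℝ} {u : EuclideanSpace ℝ (Fin n) → ℝ → ℝ}
    (hf : ContDiff ℝ 1 f) (hg : Continuous g) (hpos : ∀ y, R ≤ ‖y‖ → 0 < f y)
    (hu : IsFreeWaveSolution f g u) {x : EuclideanSpace ℝ (Fin n)} {t : ℝ}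
    (hxt : (x, t) ∈ sigmaTwo n R) :
    t * ∫ z, dataCombination f g (x + t • z) ∂m ≤ m.real Set.univ * u x t := by
  have hint {H : EuclideanSpace ℝ (Fin n) → ℝ} (hH : Continuous H) : Integrable H m := by
    have h1 := hH.continuousOn.integrableOn_compact (μ := m)
      (isCompact_closedBall (0 : EuclideanSpace ℝ (Fin n)) 1)
    rwa [IntegrableOn, Measure.restrict_eq_self_of_ae_mem (by simpa using hm.norm_le_one)] at h1
  have hfd : Continuous (fderiv ℝ f) := hf.continuous_fderiv one_ne_zero
  have hfc := hf.continuous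
  have hdc := continuous_dataCombination hf hg
  rw [← hm.integral_data_eq hu x hxt.1, ← integral_const_mul]
  refine integral_mono_ae (hint (by fun_prop)) (hint (by fun_prop)) ?_
  filter_upwards [hm.norm_le_one] with z hz using mul_dataCombination_le hpos hxt hz

/-- The substitution `ρ = t sin θ` in the Poisson integral. -/
theorem integral_div_sqrt_mul_eq (S : ℝ → ℝ) {t : ℝ} (ht : 0 < t) :
    ∫ ρ in (0 : ℝ)..t, ρ / Real.sqrt (t ^ 2 - ρ ^ 2) * S ρ =
      t * ∫ θ in (0 : ℝ)..(Real.pi / 2), Real.sin θ * S (t * Real.sin θ) := by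
  have hpi := Real.pi_pos
  have himage : (fun θ => t * Real.sin θ) '' Set.Ioo 0 (Real.pi / 2) = Set.Ioo 0 t := by
    ext ρ
    constructor
    · rintro ⟨θ, hθ, rfl⟩
      have h0 : 0 < Real.sin θ := Real.sin_pos_of_pos_of_lt_pi hθ.1 (by linarith [hθ.2])
      have h1 : Real.sin θ < 1 := by
        rw [← Real.sin_pi_div_two]
        exact Real.sin_lt_sin_of_lt_of_le_pi_div_two (by linarith [hθ.1]) le_rfl hθ.2
      exact ⟨mul_pos ht h0, by simpa using mul_lt_mul_of_pos_left h1 ht⟩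
    · intro hρ
      have h1 : ρ / t < 1 := (div_lt_one ht).2 hρ.2
      have h0 : 0 < ρ / t := div_pos hρ.1 ht
      refine ⟨Real.arcsin (ρ / t), ⟨Real.arcsin_pos.2 h0, Real.arcsin_lt_pi_div_two.2 h1⟩, ?_⟩
      simp only
      rw [Real.sin_arcsin (by linarith) h1.le]
      field_simp
  have hinj : Set.InjOn (fun θ => t * Real.sin θ) (Set.Ioo 0 (Real.pi / 2)) := by
    intro a ha b hb hab
    exact Real.injOn_sin ⟨by linarith [ha.1], ha.2.le⟩ ⟨by linarith [hb.1], hb.2.le⟩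
      (mul_left_cancel₀ ht.ne' hab)
  -- The open interval avoids `θ = π / 2`, where the integrand on the left is singular.
  rw [intervalIntegral.integral_of_le ht.le, integral_Ioc_eq_integral_Ioo, ← himage,
    integral_image_eq_integral_abs_deriv_smul (f' := fun θ => t * Real.cos θ) measurableSet_Ioo
      (fun θ _ => ((Real.hasDerivAt_sin θ).const_mul t).hasDerivWithinAt) hinj,
    intervalIntegral.integral_of_le (by positivity), integral_Ioc_eq_integral_Ioo,
    ← integral_const_mul]
  refine setIntegral_congr_fun measurableSet_Ioo fun θ hθ => ?_
  have hcos : 0 < Real.cos θ := Real.cos_pos_of_mem_Ioo ⟨by linarith [hθ.1], hθ.2⟩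
  have hsqrt : Real.sqrt (t ^ 2 - (t * Real.sin θ) ^ 2) = t * Real.cos θ := by
    rw [← Real.sqrt_sq (mul_pos ht hcos).le]
    congr 1
    linear_combination (-t ^ 2) * Real.cos_sq' θ
  simp only [hsqrt, abs_of_pos (mul_pos ht hcos), smul_eq_mul]
  field_simp

theorem mainTheorem4 :
    (∀ (f g : EuclideanSpace ℝ (Fin 3) → ℝ) (R C₀ κ : ℝ)
        (u : EuclideanSpace ℝ (Fin 3) → ℝ → ℝ),
      LowDimAssumption f g R C₀ κ → IsFreeWaveSolution f g u →
        ∀ (x : EuclideanSpace ℝ (Fin 3)) (t : ℝ), (x, t) ∈ sigmaTwo 3 R →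
          kirchhoffIntegral (dataCombination f g) x t ≤ u x t) ∧
    (∀ (f g : EuclideanSpace ℝ (Fin 2) → ℝ) (R C₀ κ : ℝ)
        (u : EuclideanSpace ℝ (Fin 2) → ℝ → ℝ),
      LowDimAssumption f g R C₀ κ → IsFreeWaveSolution f g u →
        ∀ (x : EuclideanSpace ℝ (Fin 2)) (t : ℝ), (x, t) ∈ sigmaTwo 2 R →
          poissonIntegral (dataCombination f g) x t ≤ u x t) := by
  refine ⟨fun f g R C₀ κ u hfg hu x t hxt => ?_, fun f g R C₀ κ u hfg hu x t hxt => ?_⟩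
  · have key := isHuygensMeasure_surfaceMeasure.mul_integral_dataCombination_le
      (hfg.contDiff_f.of_le (by norm_num)) hfg.contDiff_g.continuous hfg.f_pos hu hxt
    rw [surfaceMeasure_real_univ, integral_surfaceMeasure] at key
    rw [kirchhoffIntegral, div_mul_eq_mul_div, div_le_iff₀' (by positivity)]
    exact key
  · have hf : ContDiff ℝ 1 f := hfg.contDiff_f.of_le (by norm_num)
    have hd := continuous_dataCombination hf hfg.contDiff_g.continuous
    have key := isHuygensMeasure_discMeasure.mul_integral_dataCombination_le
      hf hfg.contDiff_g.continuous hfg.f_pos hu hxt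
    rw [discMeasure_real_univ, integral_discMeasure _ (by fun_prop)] at key
    rw [poissonIntegral, div_mul_eq_mul_div, one_mul, div_le_iff₀' (by positivity),
      integral_div_sqrt_mul_eq _ hxt.1]
    simpa only [sphereIntegral, smul_smul] using key
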